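/- **Theorem 2.** For each $k\in\mathbb N=\{1,2,\dots\}$ let $\mathbf N_k=\{0,1,\dots,N_k\}$ with $0<N_k\le\infty$ (for $N_k=\infty$ this means $\mathbf N_k=\{0,1,2,\dots\}$), and let $\widetilde Q=\|q_{ik}\|$, $i\in\mathbf N_k$, $k\in\mathbb N$, be real numbers with $$q_{ik}>0,\qquad \sum_{i\in\mathbf N_k}q_{ik}=1\ \ (k\in\mathbb N),\qquad \prod_{k=1}^\infty\max_{i\in\mathbf N_k}q_{ik}=0 .$$ For a sequence $(i_k)$ with $i_k\in\mathbf N_k$, define nested closed intervals $[0,1]\supset\Delta^{\widetilde Q}_{i_1}\supset\Delta^{\widetilde Q}_{i_1i_2}\supset\cdots$ as follows: with $a_0=0$, $\ell_0=1$, $a_k=a_{k-1}+\ell_{k-1}\sum_{i<i_k}q_{ik}$ and $\ell_k=\ell_{k-1}q_{i_kk}$, put $\Delta^{\widetilde Q}_{i_1\dots i_k}=[a_k,a_k+\ell_k]$. Thus each interval of rank $k-1$ is decomposed from left to right into intervals of rank $k$ whose lengths are in the ratio $q_{0k}:q_{1k}:\cdots$. Let $\Delta^{\widetilde Q}_{i_1i_2\dots}$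 denote the unique point common to all the intervals $\Delta^{\widetilde Q}_{i_1\dots i_k}$, $k\ge1$. Let $\xi_1,\xi_2,\dots$ be independent random variables, $\xi_k$ with values in $\mathbf N_k$ and $P(\xi_k=i)=p_{ik}\ge0$, $\sum_{i\in\mathbf N_k}p_{ik}=1$, and let $\mu_\xi$ be the distribution of $\xi=\Delta^{\widetilde Q}_{\xi_1\xi_2\dots}$. Call a Borel probability measure on $\mathbb R$ purely absolutely continuous if it is absolutely continuous with respect to Lebesgue measure, purely point if it is concentrated on a countable set, and purely singular continuous if it has no atoms and is singular with respect to Lebesgue measure. Then $\mu_\xi$ is of pure type, i.e. it is of exactly one of these three types. Moreover the infinite products $$\rho=\prod_{k=1}^\infty\Big(\sum_{i\in\mathbf N_k}\sqrt{p_{ik}q_{ik}}\Big),\qquad P_{\max}=\prod_{k=1}^\infty\max_{i\in\mathbf N_k}p_{ik}$$ exist in $[0,1]$ as limits of their partial products, and 1. $\mu_\xi$ is purely absolutely continuous if and only if $\rho>0$; 2. $\mu_\xi$ is purely point if and only if $P_{\max}>0$; 3. $\mu_\xi$ is purely singular continuous if and only if $\rho=0=P_{\max}$. -/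

import Mathlib

open MeasureTheory ProbabilityTheory Filter Topology

noncomputable section

/-- The alphabet `{0, 1, ..., N}`, where `N = ∞` is allowed (and gives all of `ℕ`). -/
abbrev Alphabet (N : ℕ∞) : Type := {i : ℕ // (i : ℕ∞) ≤ N}

/-- A `Q̃`-matrix: column `k` has a positive entry `q k i` for every `i` in the alphabet
`{0, ..., N k}`, `0 < N k ≤ ∞`; each column sums to `1`; and the infinite product of the largest
entries of the columns is `0`. Columns are numbered from `0`. -/
structure QTildeMatrix where
  N : ℕ → ℕ∞
  N_pos : ∀ k, 0 < N k
  q : ∀ k, Alphabet (N k) → ℝ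
  q_pos : ∀ k i, 0 < q k i
  q_sum : ∀ k, HasSum (q k) 1
  prod_max : Tendsto (fun n : ℕ => ∏ k ∈ Finset.range n, ⨆ i, q k i) atTop (𝓝 0)

namespace QTildeMatrix

variable (Q : QTildeMatrix)

/-- The sum `q k 0 + ... + q k (i - 1)` of the entries of column `k` before the `i`-th one. -/
def partialSum (k : ℕ) (i : Alphabet (Q.N k)) : ℝ :=
  ∑ j : Fin i.1, Q.q k ⟨j.1, le_trans (by exact_mod_cast j.2.le) i.2⟩

/-- The length `∏_{k < n} q k (s k)` of the rank `n` interval with address `s 0, ..., s (n-1)`. -/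
def cylLength (s : ∀ k, Alphabet (Q.N k)) (n : ℕ) : ℝ :=
  ∏ k ∈ Finset.range n, Q.q k (s k)

/-- The left end point of the rank `n` interval with address `s 0, ..., s (n-1)`. The unique rank
`0` interval is `[0, 1]`; each rank `n` interval is cut, from the left to the right, into rank
`n + 1` intervals whose lengths are to its own length as `q n 0 : q n 1 : ...` to `1`. -/
def cylLeft (s : ∀ k, Alphabet (Q.N k)) : ℕ → ℝ
  | 0 => 0
  | n + 1 => cylLeft s n + Q.cylLength s n * Q.partialSum n (s n)

/-- The closed rank `n` interval with address `s 0, ..., s (n-1)`. -/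
def cylinder (s : ∀ k, Alphabet (Q.N k)) (n : ℕ) : Set ℝ :=
  Set.Icc (Q.cylLeft s n) (Q.cylLeft s n + Q.cylLength s n)

theorem partialSum_nonneg (k : ℕ) (i : Alphabet (Q.N k)) : 0 ≤ Q.partialSum k i :=
  Finset.sum_nonneg fun _ _ => (Q.q_pos k _).le

theorem partialSum_add_le (k : ℕ) (i : Alphabet (Q.N k)) : Q.partialSum k i + Q.q k i ≤ 1 := by
  have hle : ∀ j : Fin (i.1 + 1), ((j.1 : ℕ) : ℕ∞) ≤ Q.N k := fun j =>
    le_trans (by exact_mod_cast Nat.lt_succ_iff.mp j.2) i.2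
  let e : Fin (i.1 + 1) ↪ Alphabet (Q.N k) :=
    ⟨fun j => ⟨j.1, hle j⟩, fun a b h => Fin.ext (congrArg Subtype.val h)⟩
  have h1 : ∑ x ∈ Finset.univ.map e, Q.q k x ≤ 1 :=
    sum_le_hasSum _ (fun x _ => (Q.q_pos k x).le) (Q.q_sum k)
  rw [Finset.sum_map, Fin.sum_univ_castSucc] at h1
  exact h1

theorem cylLength_pos (s : ∀ k, Alphabet (Q.N k)) (n : ℕ) : 0 < Q.cylLength s n :=
  Finset.prod_pos fun _ _ => Q.q_pos _ _

theorem bddAbove_q (k : ℕ) : BddAbove (Set.range (Q.q k)) :=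
  ⟨1, by
    rintro _ ⟨i, rfl⟩
    have h1 := Q.partialSum_add_le k i
    have h2 := Q.partialSum_nonneg k i
    linarith⟩

theorem tendsto_cylLength (s : ∀ k, Alphabet (Q.N k)) :
    Tendsto (Q.cylLength s) atTop (𝓝 0) :=
  squeeze_zero (fun n => (Q.cylLength_pos s n).le)
    (fun _ => Finset.prod_le_prod (fun _ _ => (Q.q_pos _ _).le)
      (fun k _ => le_ciSup (Q.bddAbove_q k) (s k))) Q.prod_max

theorem cylLeft_mono (s : ∀ k, Alphabet (Q.N k)) : Monotone (Q.cylLeft s) :=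
  monotone_nat_of_le_succ fun n => by
    have h := mul_nonneg (Q.cylLength_pos s n).le (Q.partialSum_nonneg n (s n))
    simp only [cylLeft]
    linarith

theorem cylRight_anti (s : ∀ k, Alphabet (Q.N k)) :
    Antitone fun n => Q.cylLeft s n + Q.cylLength s n :=
  antitone_nat_of_succ_le fun n => by
    have h := mul_le_mul_of_nonneg_left (Q.partialSum_add_le n (s n)) (Q.cylLength_pos s n).le
    have h2 : Q.cylLength s (n + 1) = Q.cylLength s n * Q.q n (s n) :=
      Finset.prod_range_succ _ _
    simp only [cylLeft, h2]
    linarith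

/-- The nested intervals with address `s` have exactly one common point. -/
theorem existsUnique_mem_cylinder (s : ∀ k, Alphabet (Q.N k)) :
    ∃! x : ℝ, ∀ n, x ∈ Q.cylinder s n := by
  have hlr : ∀ m n, Q.cylLeft s m ≤ Q.cylLeft s n + Q.cylLength s n := fun m n => by
    have h1 := Q.cylLeft_mono s (le_max_left m n)
    have h2 := Q.cylRight_anti s (le_max_right m n)
    have h3 := Q.cylLength_pos s (max m n)
    simp only at h2
    linarith
  have hb : BddAbove (Set.range (Q.cylLeft s)) := ⟨Q.cylLeft s 0 + Q.cylLength s 0, by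
    rintro _ ⟨m, rfl⟩
    exact hlr m 0⟩
  refine ⟨⨆ m, Q.cylLeft s m, fun n => ⟨le_ciSup hb n, ciSup_le fun m => hlr m n⟩, ?_⟩
  · intro y hy
    apply le_antisymm
    · refine ge_of_tendsto (f := fun n => (⨆ m, Q.cylLeft s m) + Q.cylLength s n)
        (x := atTop) ?_ (Eventually.of_forall fun n => ?_)
      · simpa using (Q.tendsto_cylLength s).const_add (⨆ m, Q.cylLeft s m)
      · exact (hy n).2.trans (by have := le_ciSup hb n; linarith)
    · exact ciSup_le fun m => (hy m).1

/-- The point `Δ_{s 0, s 1, ...}` whose `Q̃`-representation is `s`: the common point of the nested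
intervals with address `s`. -/
def point (s : ∀ k, Alphabet (Q.N k)) : ℝ :=
  (Q.existsUnique_mem_cylinder s).choose

theorem point_mem_cylinder (s : ∀ k, Alphabet (Q.N k)) (n : ℕ) :
    Q.point s ∈ Q.cylinder s n :=
  (Q.existsUnique_mem_cylinder s).choose_spec.1 n

/-- The point depends measurably on its address, so that its law below is the push-forward. -/
theorem measurable_point : Measurable Q.point := by
  have hlen : ∀ n, Measurable fun s => Q.cylLength s n := fun n =>
    Finset.measurable_prod _ fun k _ =>
      (measurable_of_countable (Q.q k)).comp (measurable_pi_apply k)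
  have hleft : ∀ n, Measurable fun s => Q.cylLeft s n := by
    intro n
    induction n with
    | zero => exact measurable_const
    | succ n ih =>
      exact ih.add ((hlen n).mul
        ((measurable_of_countable (Q.partialSum n)).comp (measurable_pi_apply n)))
  refine measurable_of_tendsto_metrizable hleft (tendsto_pi_nhds.mpr fun s => ?_)
  refine tendsto_of_tendsto_of_tendsto_of_le_of_le
    (g := fun n => Q.point s - Q.cylLength s n) (h := fun _ => Q.point s) ?_ tendsto_const_nhds
    (fun n => ?_) (fun n => (Q.point_mem_cylinder s n).1)
  · simpa using (Q.tendsto_cylLength s).const_sub (Q.point s)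
  · have := (Q.point_mem_cylinder s n).2
    simp only
    linarith

/-- The distribution `μ_ξ` of the random variable `ξ = Δ_{ξ 0, ξ 1, ...}`. -/
def law {Ω : Type*} [MeasurableSpace Ω] (P : Measure Ω)
    (ξ : ∀ k, Ω → Alphabet (Q.N k)) : Measure ℝ :=
  P.map fun ω => Q.point fun k => ξ k ω

end QTildeMatrix

/-- Purely absolutely continuous with respect to Lebesgue measure. -/
def IsPurelyAC (μ : Measure ℝ) : Prop := μ ≪ volume

/-- Purely point (discrete): concentrated on a countable set. -/
def IsPurelyPoint (μ : Measure ℝ) : Prop := ∃ S : Set ℝ, S.Countable ∧ μ Sᶜ = 0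

/-- Purely singular continuous: without atoms, and singular to Lebesgue measure. -/
def IsPurelySC (μ : Measure ℝ) : Prop := (∀ x : ℝ, μ {x} = 0) ∧ μ ⟂ₘ volume

end

/-! This is Kakutani's dichotomy, carried out on finite words. A word `w` of length `n` has
probability `weight p n w` as a prefix of `ξ`, and its interval has length `weight Q.q n w`. The
Hellinger affinity of these two weights is the `n`-th partial product of `ρ`.

If `ρ = 0`, the words with `q`-weight at most their `p`-weight cover a set of small volume whose
complement has small law, so the law is singular (`law_mutuallySingular`). If `ρ > 0`, the columns
from some rank on have affinity near `1`, and the finitely many earlier ones can be truncated to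
letters on which `p / q` is bounded. Hence small total length forces small probability, uniformly in
the rank (`exists_uniform_bound`), and absolute continuity follows by approximating null sets by
open sets (`law_absolutelyContinuous`).

For atoms, every point has countably many addresses, each of probability at most `Pmax`, so `Pmax =
0` excludes atoms (`law_singleton_eq_zero`). If `Pmax > 0`, Borel–Cantelli shows that almost surely
`ξ k` is eventually the most probable letter, which leaves countably many values
(`law_isPurelyPoint`).

The converse implications and the purity of type then follow because a nonzero measure is neither
both absolutely continuous and singular, nor both atomless and carried by a countable set. -/

/-! ### Finite words over varying alphabets -/

/-- Words of length `n` whose `k`-th letter lies in `A k`. -/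
def PrefixWord (A : ℕ → Type) : ℕ → Type
  | 0 => Unit
  | n + 1 => PrefixWord A n × A n

namespace PrefixWord

variable {A : ℕ → Type}

instance instCountable [∀ k, Countable (A k)] : ∀ n, Countable (PrefixWord A n)
  | 0 => inferInstanceAs (Countable Unit)
  | n + 1 =>
    haveI := instCountable n
    inferInstanceAs (Countable (PrefixWord A n × A n))

/-- The word formed by the first `n` letters of a sequence. -/
def take (s : ∀ k, A k) : ∀ n, PrefixWord A n
  | 0 => ()
  | n + 1 => (take s n, s n)

/-- The product of the values of `f` along the letters of a word. -/
def weight (f : ∀ k, A k → ℝ) : ∀ n, PrefixWord A n → ℝ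
  | 0, _ => 1
  | n + 1, w => weight f n w.1 * f n w.2

theorem weight_take (f : ∀ k, A k → ℝ) (s : ∀ k, A k) (n : ℕ) :
    weight f n (take s n) = ∏ k ∈ Finset.range n, f k (s k) := by
  induction n with
  | zero => simp [weight]
  | succ n ih => rw [Finset.prod_range_succ, ← ih]; rfl

theorem take_eq_take_iff {s t : ∀ k, A k} {n : ℕ} :
    take s n = take t n ↔ ∀ k < n, s k = t k := by
  induction n with
  | zero => exact ⟨fun _ k hk => absurd hk k.not_lt_zero, fun _ => rfl⟩
  | succ n ih =>
    change (take s n, s n) = (take t n, t n) ↔ _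
    rw [Prod.mk.injEq, ih]
    constructor
    · rintro ⟨h1, h2⟩ k hk
      rcases Nat.lt_succ_iff_lt_or_eq.mp hk with h | rfl
      exacts [h1 k h, h2]
    · exact fun h => ⟨fun k hk => h k (hk.trans n.lt_succ_self), h n n.lt_succ_self⟩

theorem take_surjective [∀ k, Nonempty (A k)] (n : ℕ) :
    Function.Surjective fun s : ∀ k, A k => take s n := by
  classical
  induction n with
  | zero => exact fun w => ⟨fun k => Classical.arbitrary _, rfl⟩
  | succ n ih =>
    rintro ⟨w, i⟩
    obtain ⟨s, rfl⟩ := ih w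
    refine ⟨Function.update s n i, Prod.ext ?_ (Function.update_self ..)⟩
    exact take_eq_take_iff.mpr fun k hk => Function.update_of_ne hk.ne _ _

theorem weight_nonneg {f : ∀ k, A k → ℝ} (hf : ∀ k i, 0 ≤ f k i) :
    ∀ n w, 0 ≤ weight f n w
  | 0, _ => zero_le_one
  | n + 1, w => mul_nonneg (weight_nonneg hf n w.1) (hf n w.2)

theorem hasSum_weight {f : ∀ k, A k → ℝ} {S : ℕ → ℝ} (hf : ∀ k i, 0 ≤ f k i)
    (hS : ∀ k, HasSum (f k) (S k)) (n : ℕ) :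
    HasSum (weight f n) (∏ k ∈ Finset.range n, S k) := by
  induction n with
  | zero => exact hasSum_unique fun _ : Unit => (1 : ℝ)
  | succ n ih =>
    rw [Finset.prod_range_succ]
    exact ih.mul (hS n)
      (ih.summable.mul_of_nonneg (hS n).summable (weight_nonneg hf n) (hf n))

/-- Together with `hasSum_weight`, this makes the affinity of two word weights the product of the
affinities of the columns. -/
theorem weight_sqrt_mul {f g : ∀ k, A k → ℝ} (hf : ∀ k i, 0 ≤ f k i) (hg : ∀ k i, 0 ≤ g k i)
    (n : ℕ) (w : PrefixWord A n) :
    weight (fun k i => √(f k i * g k i)) n w = √(weight f n w * weight g n w) := by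
  induction n with
  | zero => simp [weight]
  | succ n ih =>
    simp only [weight]
    rw [ih, ← Real.sqrt_mul (mul_nonneg (weight_nonneg hf _ _) (weight_nonneg hg _ _))]
    congr 1
    ring

theorem weight_le_mul_weight {f g : ∀ k, A k → ℝ} {K : ℕ → ℝ} (hf : ∀ k i, 0 ≤ f k i)
    (h : ∀ k i, f k i ≤ K k * g k i) (n : ℕ) (w : PrefixWord A n) :
    weight f n w ≤ (∏ k ∈ Finset.range n, K k) * weight g n w := by
  induction n with
  | zero => simp [weight]
  | succ n ih =>
    rw [Finset.prod_range_succ]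
    calc weight f n w.1 * f n w.2
        ≤ ((∏ k ∈ Finset.range n, K k) * weight g n w.1) * (K n * g n w.2) :=
          mul_le_mul (ih w.1) (h n w.2) (hf n w.2) ((weight_nonneg hf n w.1).trans (ih w.1))
      _ = _ := by simp only [weight]; ring

end PrefixWord

/-- A sequence that agrees with `m` from `n` on is determined by its prefix of length `n`. This
serves both for addresses ending in zeros and for those ending in most probable letters. -/
theorem countable_setOf_eventually_eq {A : ℕ → Type} [∀ k, Countable (A k)] (m : ∀ k, A k) :
    {s : ∀ k, A k | ∀ᶠ k in atTop, s k = m k}.Countable := by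
  have : {s : ∀ k, A k | ∀ᶠ k in atTop, s k = m k} =
      ⋃ n, {s : ∀ k, A k | ∀ k ≥ n, s k = m k} := by
    ext s
    simp [eventually_atTop]
  rw [this]
  refine Set.countable_iUnion fun n => ?_
  refine Set.MapsTo.countable_of_injOn (f := fun s => PrefixWord.take s n) (t := Set.univ)
    (fun _ _ => Set.mem_univ _) (fun s hs t ht hst => ?_) (Set.to_countable _)
  ext k
  rcases lt_or_ge k n with hk | hk
  · exact PrefixWord.take_eq_take_iff.mp hst k hk
  · exact (hs k hk).trans (ht k hk).symm

/-! ### Hellinger affinity -/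

theorem sqrt_mul_le_half_add {x y : ℝ} (hx : 0 ≤ x) (hy : 0 ≤ y) : √(x * y) ≤ (x + y) / 2 := by
  rw [Real.sqrt_le_left (by positivity)]
  nlinarith [sq_nonneg (x - y)]

theorem summable_sqrt_mul {ι : Type*} {a b : ι → ℝ} (ha : ∀ i, 0 ≤ a i) (hb : ∀ i, 0 ≤ b i)
    (hsa : Summable a) (hsb : Summable b) : Summable fun i => √(a i * b i) :=
  Summable.of_nonneg_of_le (fun _ => Real.sqrt_nonneg _)
    (fun i => sqrt_mul_le_half_add (ha i) (hb i)) ((hsa.add hsb).div_const 2)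

/-- If the affinity of two weights is close to `1`, a set that is small for the second weight is
small for the first. -/
theorem tsum_indicator_le_of_affinity {ι : Type*} {a b : ι → ℝ} {B c t : ℝ}
    (ha : ∀ i, 0 ≤ a i) (hb : ∀ i, 0 ≤ b i) (hsa : HasSum a 1) (hsb : HasSum b B) (hB : B ≤ 1)
    (hc : HasSum (fun i => √(a i * b i)) c) (ht : 0 < t) (C : Set ι) :
    ∑' i, C.indicator a i ≤ 2 * (1 - c) + t + (∑' i, C.indicator b i) / t := by
  have hCa := (hsa.summable.indicator C).hasSum
  have hCb := (hsb.summable.indicator C).hasSum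
  set u := ∑' i, C.indicator a i
  set v := ∑' i, C.indicator b i
  -- On `C` this is AM-GM for `t * a i` and `b i / t`; off `C` it is AM-GM for `a i` and `b i`.
  -- Summing and using `B ≤ 1` gives the claim.
  have hle : ∀ i, √(a i * b i) ≤
      (a i + b i) / 2 - C.indicator a i / 2 + t * a i / 2 + C.indicator b i / t / 2 := by
    intro i
    have h1 := ha i
    have h2 := hb i
    by_cases hi : i ∈ C
    · have h3 := sqrt_mul_le_half_add (mul_nonneg ht.le h1) (div_nonneg h2 ht.le)
      rw [show t * a i * (b i / t) = a i * b i by field_simp] at h3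
      simp only [Set.indicator_of_mem hi]
      linarith
    · have h3 := sqrt_mul_le_half_add h1 h2
      have h4 := mul_nonneg ht.le h1
      simp only [Set.indicator_of_notMem hi, zero_div]
      linarith
  have hsum := ((((hsa.add hsb).div_const 2).sub (hCa.div_const 2)).add
    ((hsa.mul_left t).div_const 2)).add ((hCb.div_const t).div_const 2)
  have := hasSum_le hle hc hsum
  linarith

/-- Only finitely many terms of a summable family reach a given positive value, so the maximum is
taken over a finite set. -/
theorem isGreatest_of_hasSum_one {ι : Type*} {f : ι → ℝ} (hf : ∀ i, 0 ≤ f i)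
    (h : HasSum f 1) : ∃ i, IsGreatest (Set.range f) (f i) := by
  obtain ⟨i₀, hi₀⟩ : ∃ i, 0 < f i := by
    by_contra! hcon
    have : f = fun _ => 0 := funext fun i => le_antisymm (hcon i) (hf i)
    exact one_ne_zero (h.unique (this ▸ hasSum_zero))
  have hfin : {i | f i₀ ≤ f i}.Finite := by
    have := h.summable.tendsto_cofinite_zero.eventually (gt_mem_nhds hi₀)
    simpa [eventually_cofinite] using this
  obtain ⟨i, hi, hmax⟩ := hfin.exists_maximalFor f _ ⟨i₀, le_refl (f i₀)⟩
  refine ⟨i, ⟨i, rfl⟩, ?_⟩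
  rintro _ ⟨j, rfl⟩
  by_cases hj : f i₀ ≤ f j
  · by_contra! hlt
    exact hlt.not_ge (hmax hj hlt.le)
  · exact (not_le.mp hj).le.trans hi

theorem exists_tendsto_prod_range {x : ℕ → ℝ} (h0 : ∀ k, 0 ≤ x k) (h1 : ∀ k, x k ≤ 1) :
    ∃ l : ℝ, 0 ≤ l ∧ (∀ n, l ≤ ∏ k ∈ Finset.range n, x k) ∧
      Tendsto (fun n => ∏ k ∈ Finset.range n, x k) atTop (𝓝 l) := by
  have hnn : ∀ n, 0 ≤ ∏ k ∈ Finset.range n, x k := fun n => Finset.prod_nonneg fun k _ => h0 k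
  have hanti : Antitone fun n => ∏ k ∈ Finset.range n, x k :=
    antitone_nat_of_succ_le fun n => by
      rw [Finset.prod_range_succ]
      exact mul_le_of_le_one_right (hnn n) (h1 n)
  have hbdd : BddBelow (Set.range fun n => ∏ k ∈ Finset.range n, x k) :=
    ⟨0, by rintro _ ⟨n, rfl⟩; exact hnn n⟩
  exact ⟨_, le_ciInf hnn, fun n => ciInf_le hbdd n, tendsto_atTop_ciInf hanti hbdd⟩

/-- Since `1 - x ≤ -log x`, the partial sums are bounded by `-log l`. -/
theorem summable_one_sub_of_prod_ge {x : ℕ → ℝ} {l : ℝ} (h1 : ∀ k, x k ≤ 1) (hl : 0 < l)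
    (hx : ∀ k, 0 < x k) (h : ∀ n, l ≤ ∏ k ∈ Finset.range n, x k) :
    Summable fun k => 1 - x k := by
  refine summable_of_sum_range_le (c := -Real.log l) (fun k => sub_nonneg.mpr (h1 k)) fun n => ?_
  calc ∑ k ∈ Finset.range n, (1 - x k)
      ≤ ∑ k ∈ Finset.range n, -Real.log (x k) :=
        Finset.sum_le_sum fun k _ => by linarith [Real.log_le_sub_one_of_pos (hx k)]
    _ = -Real.log (∏ k ∈ Finset.range n, x k) := by
        rw [Finset.sum_neg_distrib, Real.log_prod fun k _ => (hx k).ne']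
    _ ≤ -Real.log l := neg_le_neg (Real.log_le_log hl (h n))

/-! ### Geometry of the cylinders -/

namespace QTildeMatrix

variable (Q : QTildeMatrix)

instance instNonemptyAlphabet (N : ℕ∞) : Nonempty (Alphabet N) := ⟨⟨0, by simp⟩⟩

/-- The left end point of the cylinder with a given finite address. -/
noncomputable def wordLeft : ∀ n, PrefixWord (fun k => Alphabet (Q.N k)) n → ℝ
  | 0, _ => 0
  | n + 1, w => wordLeft n w.1 + PrefixWord.weight Q.q n w.1 * Q.partialSum n w.2

theorem wordLeft_take (s : ∀ k, Alphabet (Q.N k)) (n : ℕ) :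
    Q.wordLeft n (PrefixWord.take s n) = Q.cylLeft s n := by
  induction n with
  | zero => rfl
  | succ n ih =>
    simp only [PrefixWord.take, wordLeft, cylLeft]
    rw [ih, PrefixWord.weight_take]
    rfl

/-- The closed cylinder with a given finite address. -/
def wordIcc (n : ℕ) (w : PrefixWord (fun k => Alphabet (Q.N k)) n) : Set ℝ :=
  Set.Icc (Q.wordLeft n w) (Q.wordLeft n w + PrefixWord.weight Q.q n w)

/-- The cylinder with a given finite address, without its right end point. -/
def wordIco (n : ℕ) (w : PrefixWord (fun k => Alphabet (Q.N k)) n) : Set ℝ :=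
  Set.Ico (Q.wordLeft n w) (Q.wordLeft n w + PrefixWord.weight Q.q n w)

theorem wordIcc_take (s : ∀ k, Alphabet (Q.N k)) (n : ℕ) :
    Q.wordIcc n (PrefixWord.take s n) = Q.cylinder s n := by
  rw [wordIcc, wordLeft_take, PrefixWord.weight_take]
  rfl

theorem wordWeight_nonneg (n : ℕ) (w : PrefixWord (fun k => Alphabet (Q.N k)) n) :
    0 ≤ PrefixWord.weight Q.q n w :=
  PrefixWord.weight_nonneg (fun k i => (Q.q_pos k i).le) n w

theorem partialSum_add_le_partialSum (k : ℕ) {i j : Alphabet (Q.N k)} (h : i.1 < j.1) :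
    Q.partialSum k i + Q.q k i ≤ Q.partialSum k j := by
  let F : Fin j.1 → ℝ := fun a => Q.q k ⟨a.1, le_trans (by exact_mod_cast a.2.le) j.2⟩
  have h1 : Q.partialSum k i + Q.q k i = ∑ a : Fin (i.1 + 1), F (Fin.castLE h a) := by
    rw [Fin.sum_univ_castSucc]
    rfl
  rw [h1]
  calc ∑ a : Fin (i.1 + 1), F (Fin.castLE h a)
      = ∑ a ∈ Finset.univ.map (Fin.castLEEmb h), F a := by rw [Finset.sum_map]; rfl
    _ ≤ ∑ a, F a := Finset.sum_le_univ_sum_of_nonneg fun a => (Q.q_pos k _).le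

theorem wordIco_subset (n : ℕ) (w : PrefixWord (fun k => Alphabet (Q.N k)) n)
    (i : Alphabet (Q.N n)) : Q.wordIco (n + 1) (w, i) ⊆ Q.wordIco n w := by
  have h0 := Q.wordWeight_nonneg n w
  have h1 := mul_nonneg h0 (Q.partialSum_nonneg n i)
  have h2 := mul_le_mul_of_nonneg_left (Q.partialSum_add_le n i) h0
  apply Set.Ico_subset_Ico
  · simp only [wordLeft]; linarith
  · simp only [wordLeft, PrefixWord.weight]; linarith

/-- Closed intervals contain every point with the given address and serve to cover; adjacent ones
share end points. Half-open ones are disjoint, so their lengths add up inside a set that contains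
them. -/
theorem pairwise_disjoint_wordIco (n : ℕ) :
    Pairwise (Function.onFun Disjoint (Q.wordIco n)) := by
  induction n with
  | zero => exact fun a b hab => (hab (Subsingleton.elim (α := Unit) a b)).elim
  | succ n ih =>
    have key : ∀ (w : PrefixWord (fun k => Alphabet (Q.N k)) n) (i j : Alphabet (Q.N n)),
        i.1 < j.1 → Disjoint (Q.wordIco (n + 1) (w, i)) (Q.wordIco (n + 1) (w, j)) := by
      intro w i j hij
      have h := mul_le_mul_of_nonneg_left (Q.partialSum_add_le_partialSum n hij)
        (Q.wordWeight_nonneg n w)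
      refine Set.disjoint_left.mpr fun x hx hy => ?_
      have h1 := hx.2
      have h2 := hy.1
      simp only [wordLeft, PrefixWord.weight] at h1 h2
      linarith
    rintro ⟨w, i⟩ ⟨v, j⟩ hne
    by_cases hwv : w = v
    · subst hwv
      have hij : i.1 ≠ j.1 := fun h => hne (by rw [Subtype.ext h])
      rcases lt_or_gt_of_ne hij with h | h
      · exact key w i j h
      · exact (key w j i h).symm
    · exact (ih hwv).mono (Q.wordIco_subset n w i) (Q.wordIco_subset n v j)

theorem summable_weight_q (n : ℕ) : Summable (PrefixWord.weight Q.q n) :=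
  (PrefixWord.hasSum_weight (fun k i => (Q.q_pos k i).le) Q.q_sum n).summable

theorem volume_biUnion_wordIcc_le (n : ℕ) (C : Set (PrefixWord (fun k => Alphabet (Q.N k)) n)) :
    volume (⋃ w ∈ C, Q.wordIcc n w) ≤
      ENNReal.ofReal (∑' w, C.indicator (PrefixWord.weight Q.q n) w) := by
  refine (measure_biUnion_le volume C.to_countable _).trans ?_
  rw [ENNReal.ofReal_tsum_of_nonneg
    (fun w => Set.indicator_nonneg (fun w _ => Q.wordWeight_nonneg n w) w)
    ((Q.summable_weight_q n).indicator C),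
    tsum_subtype C fun w => volume (Q.wordIcc n w)]
  refine ENNReal.tsum_le_tsum fun w => ?_
  by_cases hw : w ∈ C
  · simp [hw, wordIcc]
  · simp [hw]

theorem tsum_indicator_weight_le_volume (n : ℕ)
    (C : Set (PrefixWord (fun k => Alphabet (Q.N k)) n)) {U : Set ℝ}
    (hU : ∀ w ∈ C, Q.wordIco n w ⊆ U) :
    ENNReal.ofReal (∑' w, C.indicator (PrefixWord.weight Q.q n) w) ≤ volume U := by
  refine le_trans (le_of_eq ?_) (measure_mono (Set.iUnion₂_subset hU))
  rw [measure_biUnion C.to_countable (fun _ _ _ _ h => Q.pairwise_disjoint_wordIco n h)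
    (fun _ _ => measurableSet_Ico), tsum_subtype C fun w => volume (Q.wordIco n w),
    ENNReal.ofReal_tsum_of_nonneg
    (fun w => Set.indicator_nonneg (fun w _ => Q.wordWeight_nonneg n w) w)
    ((Q.summable_weight_q n).indicator C)]
  refine tsum_congr fun w => ?_
  by_cases hw : w ∈ C
  · simp [hw, wordIco]
  · simp [hw]

theorem eventually_cylinder_subset {s : ∀ k, Alphabet (Q.N k)} {U : Set ℝ} (hU : IsOpen U)
    (hs : Q.point s ∈ U) : ∀ᶠ n in atTop, Q.cylinder s n ⊆ U := by
  obtain ⟨ε, hε, hball⟩ := Metric.isOpen_iff.mp hU _ hs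
  filter_upwards [(Q.tendsto_cylLength s).eventually (gt_mem_nhds hε)] with n hn x hx
  apply hball
  have h1 := Q.point_mem_cylinder s n
  rw [Metric.mem_ball, Real.dist_eq, abs_lt]
  constructor <;> linarith [h1.1, h1.2, hx.1, hx.2]

theorem cylinder_anti (s : ∀ k, Alphabet (Q.N k)) : Antitone (Q.cylinder s) :=
  fun _ _ h => Set.Icc_subset_Icc (Q.cylLeft_mono s h) (Q.cylRight_anti s h)

/-! ### Points with several addresses -/

/-- At rank `n + 1` the interval of `s` lies to the left of that of `t`, so a common point must be
the left end point of the latter. A later nonzero letter of `t` would push the left end point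
strictly past it. -/
theorem eventually_eq_zero_of_point_eq {s t : ∀ k, Alphabet (Q.N k)} {n : ℕ}
    (heq : ∀ k < n, s k = t k) (hlt : (s n).1 < (t n).1) (h : Q.point s = Q.point t) :
    ∀ k > n, (t k).1 = 0 := by
  have hleft : Q.cylLeft s n = Q.cylLeft t n := by
    rw [← wordLeft_take, ← wordLeft_take, PrefixWord.take_eq_take_iff.mpr heq]
  have hlen : Q.cylLength s n = Q.cylLength t n :=
    Finset.prod_congr rfl fun k hk => by rw [heq k (Finset.mem_range.mp hk)]
  have hge : Q.point t ≤ Q.cylLeft t (n + 1) := by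
    have h1 := (Q.point_mem_cylinder s (n + 1)).2
    have h2 := mul_le_mul_of_nonneg_left (Q.partialSum_add_le_partialSum n hlt)
      (Q.cylLength_pos s n).le
    have h3 : Q.cylLength s (n + 1) = Q.cylLength s n * Q.q n (s n) :=
      Finset.prod_range_succ _ _
    simp only [cylLeft] at h1 ⊢
    rw [← hleft, ← hlen, ← h]
    linarith
  intro k hk
  have h1 := hge.trans (Q.cylLeft_mono t (Nat.succ_le_of_lt hk))
  have h2 := (Q.point_mem_cylinder t (k + 1)).1
  simp only [cylLeft] at h2
  by_contra h0
  have h3 := Q.partialSum_add_le_partialSum k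
    (i := ⟨0, by simp⟩) (j := t k) (Nat.pos_of_ne_zero h0)
  have h4 : 0 < Q.partialSum k (t k) :=
    (add_pos_of_nonneg_of_pos (Q.partialSum_nonneg k _) (Q.q_pos k _)).trans_le h3
  have h5 := mul_pos (Q.cylLength_pos t k) h4
  linarith

/-- Of two addresses of `x`, the one with the larger letter at the first difference ends in zeros.
Hence at most one address of `x` does not, and the addresses that do are countably many. -/
theorem countable_point_preimage (x : ℝ) : {s | Q.point s = x}.Countable := by
  set Z : Set (∀ k, Alphabet (Q.N k)) := {s | ∀ᶠ k in atTop, s k = ⟨0, by simp⟩} with hZ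
  have hev : ∀ (s : ∀ k, Alphabet (Q.N k)) (n : ℕ), (∀ k > n, (s k).1 = 0) → s ∈ Z :=
    fun s n h => (eventually_gt_atTop n).mono fun k hk => Subtype.ext (h k hk)
  have hsub : ({s | Q.point s = x} \ Z).Subsingleton := by
    rintro s ⟨hs, hsZ⟩ t ⟨ht, htZ⟩
    by_contra hne
    have hex : ∃ k, s k ≠ t k := Function.ne_iff.mp hne
    classical
    have hlt : ∀ k < Nat.find hex, s k = t k := fun k hk => not_not.mp (Nat.find_min hex hk)
    have hn : (s (Nat.find hex)).1 ≠ (t (Nat.find hex)).1 :=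
      fun h => Nat.find_spec hex (Subtype.ext h)
    have hst : Q.point s = Q.point t := Eq.trans hs (Eq.symm ht)
    rcases lt_or_gt_of_ne hn with h | h
    · exact htZ (hev t _ (Q.eventually_eq_zero_of_point_eq hlt h hst))
    · exact hsZ (hev s _ (Q.eventually_eq_zero_of_point_eq (fun k hk => (hlt k hk).symm) h
        hst.symm))
  exact (((countable_setOf_eventually_eq _).union hsub.countable)).mono
    fun s hs => by by_cases h : s ∈ Z; exacts [Or.inl h, Or.inr ⟨hs, h⟩]

end QTildeMatrix

/-! ### The law of the prefixes -/

section Prefix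

variable {Ω : Type*} {A : ℕ → Type} {ξ : ∀ k, Ω → A k}

theorem setOf_take_eq (s : ∀ k, A k) (n : ℕ) :
    {ω | PrefixWord.take (fun k => ξ k ω) n = PrefixWord.take s n} =
      ⋂ k ∈ Finset.range n, ξ k ⁻¹' {s k} := by
  ext ω
  simp [PrefixWord.take_eq_take_iff]

theorem setOf_take_mem (n : ℕ) (C : Set (PrefixWord A n)) :
    {ω | PrefixWord.take (fun k => ξ k ω) n ∈ C} =
      ⋃ w ∈ C, {ω | PrefixWord.take (fun k => ξ k ω) n = w} := by
  ext ω
  simp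

variable [MeasurableSpace Ω] {P : Measure Ω} [∀ k, MeasurableSpace (A k)]
  [∀ k, MeasurableSingletonClass (A k)] {p : ∀ k, A k → ℝ}

theorem measurableSet_take_eq [∀ k, Nonempty (A k)] (hξ : ∀ k, Measurable (ξ k)) (n : ℕ)
    (w : PrefixWord A n) : MeasurableSet {ω | PrefixWord.take (fun k => ξ k ω) n = w} := by
  obtain ⟨s, rfl⟩ := PrefixWord.take_surjective n w
  simp only
  rw [setOf_take_eq]
  exact Finset.measurableSet_biInter _ fun k _ => hξ k (measurableSet_singleton _)

theorem measure_take_eq [∀ k, Nonempty (A k)] (hp : ∀ k i, 0 ≤ p k i) (hind : iIndepFun ξ P)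
    (hlaw : ∀ k i, P {ω | ξ k ω = i} = ENNReal.ofReal (p k i)) (n : ℕ) (w : PrefixWord A n) :
    P {ω | PrefixWord.take (fun k => ξ k ω) n = w} =
      ENNReal.ofReal (PrefixWord.weight p n w) := by
  obtain ⟨s, rfl⟩ := PrefixWord.take_surjective n w
  simp only
  rw [setOf_take_eq, hind.measure_inter_preimage_eq_mul (Finset.range n)
    (fun k _ => measurableSet_singleton (s k)), PrefixWord.weight_take,
    ENNReal.ofReal_prod_of_nonneg fun k _ => hp k _]
  exact Finset.prod_congr rfl fun k _ => hlaw k (s k)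

theorem measure_take_mem [∀ k, Nonempty (A k)] [∀ k, Countable (A k)]
    (hp : ∀ k i, 0 ≤ p k i) (hp1 : ∀ k, HasSum (p k) 1)
    (hξ : ∀ k, Measurable (ξ k)) (hind : iIndepFun ξ P)
    (hlaw : ∀ k i, P {ω | ξ k ω = i} = ENNReal.ofReal (p k i)) (n : ℕ)
    (C : Set (PrefixWord A n)) :
    P {ω | PrefixWord.take (fun k => ξ k ω) n ∈ C} =
      ENNReal.ofReal (∑' w, C.indicator (PrefixWord.weight p n) w) := by
  rw [setOf_take_mem, measure_biUnion C.to_countable ?_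
    (fun w _ => measurableSet_take_eq hξ n w),
    tsum_subtype C fun w => P {ω | PrefixWord.take (fun k => ξ k ω) n = w},
    ENNReal.ofReal_tsum_of_nonneg
    (fun w => Set.indicator_nonneg (fun w _ => PrefixWord.weight_nonneg hp n w) w)
    ((PrefixWord.hasSum_weight hp hp1 n).summable.indicator C)]
  · refine tsum_congr fun w => ?_
    by_cases hw : w ∈ C
    · simp [hw, measure_take_eq hp hind hlaw]
    · simp [hw]
  · intro v _ w _ hvw
    exact Set.disjoint_left.mpr fun ω h1 h2 => hvw (Eq.trans (Eq.symm h1) h2)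

end Prefix

/-! ### Uniform absolute continuity of the weights -/

/-- On an infinite alphabet `p / q` may be unbounded, so `p` is restricted to a finite set of mass
above `θ`. The affinity of `p` with its restriction is the mass of the restriction. The summand `1`
in `K` keeps it positive. -/
theorem exists_truncation {ι : Type*} {p q : ι → ℝ} {θ : ℝ} (hp : ∀ i, 0 ≤ p i)
    (hq : ∀ i, 0 < q i) (hp1 : HasSum p 1) (hθ : θ < 1) :
    ∃ (r : ι → ℝ) (S K : ℝ), (∀ i, 0 ≤ r i) ∧ HasSum r S ∧ θ ≤ S ∧ S ≤ 1 ∧ 1 ≤ K ∧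
      (∀ i, r i ≤ K * q i) ∧ ∀ i, √(p i * r i) = r i := by
  classical
  obtain ⟨F, hF⟩ := (hp1.eventually (lt_mem_nhds hθ)).exists
  have hnn : ∀ i, 0 ≤ p i / q i := fun i => div_nonneg (hp i) (hq i).le
  have hK : 0 ≤ ∑ i ∈ F, p i / q i := Finset.sum_nonneg fun i _ => hnn i
  refine ⟨fun i => if i ∈ F then p i else 0, ∑ i ∈ F, p i, 1 + ∑ i ∈ F, p i / q i,
    fun i => ?_, ?_, hF.le, sum_le_hasSum F (fun i _ => hp i) hp1, by linarith,
    fun i => ?_, fun i => ?_⟩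
  · dsimp only
    split_ifs
    exacts [hp i, le_rfl]
  · rw [Finset.sum_congr rfl fun i hi => (if_pos hi).symm]
    exact hasSum_sum_of_ne_finset_zero fun i hi => if_neg hi
  · dsimp only
    split_ifs with hi
    · have h1 := Finset.single_le_sum (fun i _ => hnn i) hi
      rw [div_le_iff₀ (hq i)] at h1
      nlinarith [hq i]
    · have := hq i
      positivity
  · dsimp only
    split_ifs
    · exact Real.sqrt_mul_self (hp i)
    · simp

/-- The weight `p` is compared not with `q`, whose affinity with `p` is only known to be at least
`ρ`, but with `r'`: truncated `p` in the first `n` columns, `q` afterwards. Its affinity with `p` is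
near `1`, and it is at most `M` times `q`, with `M` independent of `m`. -/
theorem exists_uniform_bound {A : ℕ → Type} {p q : ∀ k, A k → ℝ} {ρ : ℝ}
    (hp : ∀ k i, 0 ≤ p k i) (hq : ∀ k i, 0 < q k i) (hp1 : ∀ k, HasSum (p k) 1)
    (hq1 : ∀ k, HasSum (q k) 1) (hρ : 0 < ρ)
    (hge : ∀ n, ρ ≤ ∏ k ∈ Finset.range n, ∑' i, √(p k i * q k i))
    (hlim : Tendsto (fun n => ∏ k ∈ Finset.range n, ∑' i, √(p k i * q k i)) atTop (𝓝 ρ))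
    {ε : ℝ} (hε : 0 < ε) :
    ∃ δ > 0, ∃ n, ∀ m ≥ n, ∀ C : Set (PrefixWord A m),
      ∑' w, C.indicator (PrefixWord.weight q m) w ≤ δ →
      ∑' w, C.indicator (PrefixWord.weight p m) w ≤ ε := by
  -- Budget in `tsum_indicator_le_of_affinity` with `t = ε / 4`: the affinity defect costs `4 * η ≤
  -- ε / 2`, and the two other terms cost at most `ε / 4` each.
  obtain ⟨η, hη0, hη1, hηε⟩ : ∃ η : ℝ, 0 < η ∧ η < 1 ∧ 8 * η ≤ ε :=
    ⟨min (ε / 8) (1 / 2), by positivity, (min_le_right _ _).trans_lt (by norm_num),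
      by linarith [min_le_left (ε / 8) (1 / 2)]⟩
  have h1η : 0 < 1 - η := sub_pos.mpr hη1
  set x : ℕ → ℝ := fun k => ∑' i, √(p k i * q k i) with hx
  -- As all partial products are at least `ρ`, the product over `Ico n m` is then at least `1 - η`
  -- for every `m ≥ n`.
  obtain ⟨n, hn⟩ : ∃ n, ∏ k ∈ Finset.range n, x k < ρ / (1 - η) :=
    (hlim.eventually (gt_mem_nhds ((lt_div_iff₀ h1η).mpr (by nlinarith)))).exists
  -- With `n` fixed, truncating each of the first `n` columns to mass at least `θ` keeps a total
  -- mass above `1 - η`.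
  obtain ⟨θ, hθpow, hθ0, hθ1⟩ : ∃ θ : ℝ, 1 - η < θ ^ n ∧ 0 < θ ∧ θ < 1 := by
    have h : ∀ᶠ θ : ℝ in 𝓝[<] 1, 1 - η < θ ^ n :=
      nhdsWithin_le_nhds ((continuous_pow n).continuousAt.eventually
        (lt_mem_nhds (by simpa using hη0)))
    exact (h.and (Ioo_mem_nhdsLT zero_lt_one)).exists
  choose r S K hr hS hθS hS1 hK hrK hsqrt using
    fun k => exists_truncation (hp k) (hq k) (hp1 k) hθ1
  let r' : ∀ k, A k → ℝ := fun k => if k < n then r k else q k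
  have hr' : ∀ k i, 0 ≤ r' k i := fun k i => by
    by_cases h : k < n
    · simpa [r', h] using hr k i
    · simpa [r', h] using (hq k i).le
  have hr'sum : ∀ k, HasSum (r' k) (if k < n then S k else 1) := fun k => by
    by_cases h : k < n
    · simpa [r', h] using hS k
    · simpa [r', h] using hq1 k
  have hr'K : ∀ k i, r' k i ≤ (if k < n then K k else 1) * q k i := fun k i => by
    by_cases h : k < n
    · simpa [r', h] using hrK k i
    · simp [r', h]
  have haff : ∀ k, HasSum (fun i => √(p k i * r' k i)) (if k < n then S k else x k) := fun k => by
    by_cases h : k < n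
    · simpa [r', h, hsqrt] using hS k
    · simpa [r', h] using (summable_sqrt_mul (hp k) (fun i => (hq k i).le)
        (hp1 k).summable (hq1 k).summable).hasSum
  set M := ∏ k ∈ Finset.range n, K k with hM
  have hM0 : 0 < M := Finset.prod_pos fun k _ => zero_lt_one.trans_le (hK k)
  have hsplit : ∀ (u v : ℕ → ℝ) (m : ℕ), n ≤ m →
      ∏ k ∈ Finset.range m, (if k < n then u k else v k) =
        (∏ k ∈ Finset.range n, u k) * ∏ k ∈ Finset.Ico n m, v k := by
    intro u v m hm
    rw [← Finset.prod_range_mul_prod_Ico _ hm]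
    congr 1
    · exact Finset.prod_congr rfl fun k hk => if_pos (Finset.mem_range.mp hk)
    · exact Finset.prod_congr rfl fun k hk => if_neg (Finset.mem_Ico.mp hk).1.not_gt
  refine ⟨ε * ε / (16 * M), by positivity, n, fun m hm C hC => ?_⟩
  have hB : ∏ k ∈ Finset.range m, (if k < n then S k else 1) ≤ 1 :=
    Finset.prod_le_one (fun k _ => by split_ifs; exacts [hθ0.le.trans (hθS k), zero_le_one])
      fun k _ => by split_ifs; exacts [hS1 k, le_rfl]
  have hwp := PrefixWord.hasSum_weight hp hp1 m
  rw [Finset.prod_const_one] at hwp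
  have hwr := PrefixWord.hasSum_weight hr' hr'sum m
  have hwa := PrefixWord.hasSum_weight (fun k i => Real.sqrt_nonneg _) haff m
  have hwa' : HasSum (fun w => √(PrefixWord.weight p m w * PrefixWord.weight r' m w)) _ :=
    hwa.congr_fun fun w => (PrefixWord.weight_sqrt_mul hp hr' m w).symm
  have hfin := tsum_indicator_le_of_affinity (PrefixWord.weight_nonneg hp m)
    (PrefixWord.weight_nonneg hr' m) hwp hwr hB hwa' (t := ε / 4) (by positivity) C
  have hc : 1 - 2 * η ≤ ∏ k ∈ Finset.range m, (if k < n then S k else x k) := by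
    rw [hsplit S x m hm]
    have h1 : 1 - η ≤ ∏ k ∈ Finset.range n, S k := by
      refine hθpow.le.trans ?_
      simpa using Finset.prod_le_prod (s := Finset.range n) (f := fun _ => θ)
        (fun _ _ => hθ0.le) (fun k _ => hθS k)
    have h2 : 1 - η ≤ ∏ k ∈ Finset.Ico n m, x k := by
      have h3 := hge m
      rw [← Finset.prod_range_mul_prod_Ico _ hm] at h3
      have h4 : 0 < ∏ k ∈ Finset.range n, x k := hρ.trans_le (hge n)
      rw [lt_div_iff₀ h1η] at hn
      by_contra! h5
      have := mul_lt_mul_of_pos_left h5 h4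
      linarith
    nlinarith [mul_le_mul h1 h2 h1η.le (h1η.le.trans h1)]
  have hCr : ∑' w, C.indicator (PrefixWord.weight r' m) w ≤ ε * ε / 16 := by
    have hqs := (PrefixWord.hasSum_weight (fun k i => (hq k i).le) hq1 m).summable.indicator C
    calc ∑' w, C.indicator (PrefixWord.weight r' m) w
        ≤ ∑' w, M * C.indicator (PrefixWord.weight q m) w := by
          refine (hwr.summable.indicator C).tsum_le_tsum (fun w => ?_) (hqs.mul_left M)
          by_cases hw : w ∈ C
          · have := PrefixWord.weight_le_mul_weight hr' hr'K m w
            rw [hsplit K (fun _ => 1) m hm] at this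
            simpa [hw] using this
          · simp [hw]
      _ = M * ∑' w, C.indicator (PrefixWord.weight q m) w := tsum_mul_left
      _ ≤ M * (ε * ε / (16 * M)) := mul_le_mul_of_nonneg_left hC hM0.le
      _ = ε * ε / 16 := by field_simp
  have hdiv : (∑' w, C.indicator (PrefixWord.weight r' m) w) / (ε / 4) ≤ ε / 4 := by
    rw [div_le_iff₀ (by positivity)]
    linarith
  linarith

/-! ### The type of the law -/

namespace QTildeMatrix

variable {Ω : Type*} [MeasurableSpace Ω] {P : Measure Ω} (Q : QTildeMatrix)
  {p : ∀ k, Alphabet (Q.N k) → ℝ} {ξ : ∀ k, Ω → Alphabet (Q.N k)}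

theorem law_apply (hξ : ∀ k, Measurable (ξ k)) {B : Set ℝ} (hB : MeasurableSet B) :
    Q.law P ξ B = P {ω | Q.point (fun k => ξ k ω) ∈ B} :=
  Measure.map_apply (Q.measurable_point.comp (measurable_pi_lambda _ hξ)) hB

theorem isProbabilityMeasure_law [IsProbabilityMeasure P] (hξ : ∀ k, Measurable (ξ k)) :
    IsProbabilityMeasure (Q.law P ξ) :=
  Measure.isProbabilityMeasure_map
    (Q.measurable_point.comp (measurable_pi_lambda _ hξ)).aemeasurable

theorem law_mutuallySingular [IsProbabilityMeasure P]
    (hp : ∀ k i, 0 ≤ p k i) (hp1 : ∀ k, HasSum (p k) 1)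
    (hξ : ∀ k, Measurable (ξ k)) (hind : iIndepFun ξ P)
    (hlaw : ∀ k i, P {ω | ξ k ω = i} = ENNReal.ofReal (p k i))
    (hlim : Tendsto (fun n => ∏ k ∈ Finset.range n, ∑' i, √(p k i * Q.q k i)) atTop (𝓝 0)) :
    Q.law P ξ ⟂ₘ volume := by
  have := Q.isProbabilityMeasure_law (P := P) hξ
  -- Lattice disjointness suffices: a measure below both the law and the volume is shown to have
  -- total mass at most `2 * X n` for every `n`.
  refine Measure.mutuallySingular_of_disjoint ?_
  intro μ hμ hvol
  have hq : ∀ k i, 0 ≤ Q.q k i := fun k i => (Q.q_pos k i).le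
  set X : ℕ → ℝ := fun n => ∏ k ∈ Finset.range n, ∑' i, √(p k i * Q.q k i)
  have hbound : ∀ n, μ Set.univ ≤ ENNReal.ofReal (X n) + ENNReal.ofReal (X n) := by
    intro n
    -- The smaller of two nonnegative numbers is at most their geometric mean, so the `q`-weight of
    -- `C` and the `p`-weight of `Cᶜ` are both at most the affinity `X n`.
    set C := {w | PrefixWord.weight Q.q n w ≤ PrefixWord.weight p n w}
    set B := ⋃ w ∈ C, Q.wordIcc n w with hB
    have hBm : MeasurableSet B := MeasurableSet.biUnion C.to_countable fun _ _ => measurableSet_Icc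
    have haff : HasSum (fun w => √(PrefixWord.weight p n w * PrefixWord.weight Q.q n w)) (X n) :=
      (PrefixWord.hasSum_weight (fun k i => Real.sqrt_nonneg _)
        (fun k => (summable_sqrt_mul (hp k) (hq k) (hp1 k).summable
          (Q.q_sum k).summable).hasSum) n).congr_fun
        fun w => (PrefixWord.weight_sqrt_mul hp hq n w).symm
    have hsum_le : ∀ (D : Set (PrefixWord (fun k => Alphabet (Q.N k)) n))
        (f : PrefixWord (fun k => Alphabet (Q.N k)) n → ℝ), Summable f →
        (∀ w ∈ D, f w ≤ √(PrefixWord.weight p n w * PrefixWord.weight Q.q n w)) →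
        ∑' w, D.indicator f w ≤ X n := by
      intro D f hf hle
      rw [← haff.tsum_eq]
      refine (hf.indicator D).tsum_le_tsum (fun w => ?_) haff.summable
      by_cases hw : w ∈ D
      · simpa [hw] using hle w hw
      · simp [hw]
    have h1 : μ B ≤ ENNReal.ofReal (X n) := by
      refine (hvol B).trans ((Q.volume_biUnion_wordIcc_le n C).trans
        (ENNReal.ofReal_le_ofReal (hsum_le C _ (Q.summable_weight_q n) fun w hw => ?_)))
      refine Real.le_sqrt_of_sq_le ?_
      rw [sq]
      exact mul_le_mul_of_nonneg_right hw (PrefixWord.weight_nonneg hq n w)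
    have h2 : μ Bᶜ ≤ ENNReal.ofReal (X n) := by
      refine (hμ Bᶜ).trans ?_
      rw [Q.law_apply hξ hBm.compl]
      refine (measure_mono (t := {ω | PrefixWord.take (fun k => ξ k ω) n ∈ Cᶜ}) ?_).trans ?_
      · intro ω hω hC
        refine hω (Set.mem_biUnion hC ?_)
        rw [wordIcc_take]
        exact Q.point_mem_cylinder _ n
      · rw [measure_take_mem hp hp1 hξ hind hlaw]
        refine ENNReal.ofReal_le_ofReal
          (hsum_le Cᶜ _ (PrefixWord.hasSum_weight hp hp1 n).summable fun w hw => ?_)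
        refine Real.le_sqrt_of_sq_le ?_
        rw [sq]
        exact mul_le_mul_of_nonneg_left (le_of_not_ge (Set.notMem_of_mem_compl hw)) (PrefixWord.weight_nonneg hp n w)
    rw [← Set.union_compl_self B]
    exact (measure_union_le _ _).trans (add_le_add h1 h2)
  have hzero : Tendsto (fun n => ENNReal.ofReal (X n) + ENNReal.ofReal (X n)) atTop (𝓝 0) := by
    have := ENNReal.tendsto_ofReal hlim
    simpa using this.add this
  have h0 : μ Set.univ = 0 := le_antisymm (ge_of_tendsto' hzero hbound) zero_le
  exact (Measure.measure_univ_eq_zero.mp h0).le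

theorem law_absolutelyContinuous {ρ : ℝ}
    (hp : ∀ k i, 0 ≤ p k i) (hp1 : ∀ k, HasSum (p k) 1)
    (hξ : ∀ k, Measurable (ξ k)) (hind : iIndepFun ξ P)
    (hlaw : ∀ k i, P {ω | ξ k ω = i} = ENNReal.ofReal (p k i)) (hρ : 0 < ρ)
    (hge : ∀ n, ρ ≤ ∏ k ∈ Finset.range n, ∑' i, √(p k i * Q.q k i))
    (hlim : Tendsto (fun n => ∏ k ∈ Finset.range n, ∑' i, √(p k i * Q.q k i)) atTop (𝓝 ρ)) :
    Q.law P ξ ≪ volume := by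
  refine Measure.AbsolutelyContinuous.mk fun E _ hE => ?_
  suffices h : ∀ ε : ℝ, 0 < ε → Q.law P ξ E ≤ ENNReal.ofReal ε by
    refine le_antisymm (ENNReal.le_of_forall_pos_le_add fun ε hε _ => ?_) zero_le
    simpa using h ε hε
  intro ε hε
  obtain ⟨δ, hδ, n, hn⟩ := exists_uniform_bound hp Q.q_pos hp1 Q.q_sum hρ hge hlim hε
  obtain ⟨U, hEU, hUo, hUδ⟩ := E.exists_isOpen_lt_of_lt (μ := volume) (ENNReal.ofReal δ)
    (by rw [hE]; exact ENNReal.ofReal_pos.mpr hδ)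
  refine (measure_mono hEU).trans ?_
  rw [Q.law_apply hξ hUo.measurableSet]
  -- These events depend only on prefixes, increase with `m` and exhaust the event that the point
  -- lies in `U`. It is enough to bound each of them.
  set G : ℕ → Set Ω := fun m => {ω | Q.cylinder (fun k => ξ k ω) m ⊆ U} with hG
  have hmono : Monotone G := fun a b hab ω hω => (Q.cylinder_anti _ hab).trans hω
  have hsub : {ω | Q.point (fun k => ξ k ω) ∈ U} ⊆ ⋃ m, G m := fun ω hω =>
    Set.mem_iUnion.mpr (Q.eventually_cylinder_subset hUo hω).exists
  refine (measure_mono hsub).trans ?_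
  rw [hmono.measure_iUnion]
  -- The uniform bound holds only from rank `n` on, so `m` is raised to `max m n`.
  refine iSup_le fun m => (measure_mono (hmono (le_max_left m n))).trans ?_
  set m' := max m n
  have hGC : G m' = {ω | PrefixWord.take (fun k => ξ k ω) m' ∈ {w | Q.wordIcc m' w ⊆ U}} := by
    ext ω
    simp [hG, wordIcc_take]
  rw [hGC, measure_take_mem hp hp1 hξ hind hlaw]
  refine ENNReal.ofReal_le_ofReal (hn m' (le_max_right m n) _ ?_)
  rw [← ENNReal.ofReal_le_ofReal_iff hδ.le]
  exact (Q.tsum_indicator_weight_le_volume m' _ fun w hw =>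
    Set.Ico_subset_Icc_self.trans hw).trans hUδ.le

theorem law_singleton_eq_zero
    (hp : ∀ k i, 0 ≤ p k i) (hbdd : ∀ k, BddAbove (Set.range (p k)))
    (hξ : ∀ k, Measurable (ξ k)) (hind : iIndepFun ξ P)
    (hlaw : ∀ k i, P {ω | ξ k ω = i} = ENNReal.ofReal (p k i))
    (hlim : Tendsto (fun n => ∏ k ∈ Finset.range n, ⨆ i, p k i) atTop (𝓝 0)) (x : ℝ) :
    Q.law P ξ {x} = 0 := by
  rw [Q.law_apply hξ (measurableSet_singleton x)]
  have hset : {ω | Q.point (fun k => ξ k ω) ∈ ({x} : Set ℝ)} =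
      ⋃ s ∈ {s | Q.point s = x}, {ω | (fun k => ξ k ω) = s} := by
    ext ω
    simp
  rw [hset, measure_biUnion_null_iff (Q.countable_point_preimage x)]
  intro s _
  have hbound : ∀ n, P {ω | (fun k => ξ k ω) = s} ≤
      ENNReal.ofReal (∏ k ∈ Finset.range n, ⨆ i, p k i) := fun n => by
    refine (measure_mono (t := {ω | PrefixWord.take (fun k => ξ k ω) n = PrefixWord.take s n})
      fun ω hω => ?_).trans ?_
    · rw [Set.mem_ofPred_eq] at hω ⊢
      rw [hω]
    · rw [measure_take_eq hp hind hlaw, PrefixWord.weight_take]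
      exact ENNReal.ofReal_le_ofReal (Finset.prod_le_prod (fun k _ => hp k _)
        fun k _ => le_ciSup (hbdd k) (s k))
  have := ENNReal.tendsto_ofReal hlim
  rw [ENNReal.ofReal_zero] at this
  exact le_antisymm (ge_of_tendsto' this hbound) zero_le

theorem law_isPurelyPoint [IsProbabilityMeasure P] (hξ : ∀ k, Measurable (ξ k))
    (hlaw : ∀ k i, P {ω | ξ k ω = i} = ENNReal.ofReal (p k i)) (hp : ∀ k i, 0 ≤ p k i)
    (m : ∀ k, Alphabet (Q.N k)) (hm : Summable fun k => 1 - p k (m k)) :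
    IsPurelyPoint (Q.law P ξ) := by
  have hc : (Q.point '' {s | ∀ᶠ k in atTop, s k = m k}).Countable :=
    (countable_setOf_eventually_eq m).image _
  refine ⟨_, hc, ?_⟩
  rw [Q.law_apply hξ hc.measurableSet.compl]
  have hne : ∀ k, P {ω | ξ k ω ≠ m k} = ENNReal.ofReal (1 - p k (m k)) := fun k => by
    rw [ENNReal.ofReal_sub _ (hp k _), ENNReal.ofReal_one, ← hlaw]
    exact prob_compl_eq_one_sub (hξ k (measurableSet_singleton (m k)))
  -- First Borel–Cantelli lemma.
  have hfreq : P {ω | ∃ᶠ k in atTop, ξ k ω ≠ m k} = 0 := by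
    refine measure_setOfPred_frequently_eq_zero (p := fun k ω => ξ k ω ≠ m k) ?_
    simp only [hne]
    exact hm.tsum_ofReal_ne_top
  refine measure_mono_null (fun ω hω => ?_) hfreq
  by_contra hcon
  refine hω ⟨_, ?_, rfl⟩
  simpa [Filter.Frequently] using hcon

end QTildeMatrix

theorem theorem2 {Ω : Type*} [MeasurableSpace Ω] (P : Measure Ω) [IsProbabilityMeasure P]
    (Q : QTildeMatrix)
    (p : ∀ k, Alphabet (Q.N k) → ℝ) (hp_nonneg : ∀ k i, 0 ≤ p k i)
    (hp_sum : ∀ k, HasSum (p k) 1)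
    (ξ : ∀ k, Ω → Alphabet (Q.N k)) (hξ_meas : ∀ k, Measurable (ξ k))
    (hξ_indep : iIndepFun ξ P)
    (hξ_law : ∀ k i, P {ω | ξ k ω = i} = ENNReal.ofReal (p k i)) :
    -- the law is of pure type: exactly one of the three types occurs
    (IsPurelyAC (Q.law P ξ) ∨ IsPurelyPoint (Q.law P ξ) ∨ IsPurelySC (Q.law P ξ)) ∧
    ¬ (IsPurelyAC (Q.law P ξ) ∧ IsPurelyPoint (Q.law P ξ)) ∧
    ¬ (IsPurelyAC (Q.law P ξ) ∧ IsPurelySC (Q.law P ξ)) ∧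
    ¬ (IsPurelyPoint (Q.law P ξ) ∧ IsPurelySC (Q.law P ξ)) ∧
    -- the series and the suprema (which are maxima) below exist
    (∀ k, Summable fun i => √(p k i * Q.q k i)) ∧
    (∀ k, ∃ i, IsGreatest (Set.range (p k)) (p k i)) ∧
    -- so do the two infinite products, and they decide the type
    ∃ ρ Pmax : ℝ,
      Tendsto (fun n : ℕ => ∏ k ∈ Finset.range n, ∑' i, √(p k i * Q.q k i)) atTop (𝓝 ρ) ∧
      Tendsto (fun n : ℕ => ∏ k ∈ Finset.range n, ⨆ i, p k i) atTop (𝓝 Pmax) ∧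
      (IsPurelyAC (Q.law P ξ) ↔ 0 < ρ) ∧
      (IsPurelyPoint (Q.law P ξ) ↔ 0 < Pmax) ∧
      (IsPurelySC (Q.law P ξ) ↔ ρ = 0 ∧ Pmax = 0) := by
  have hprob := Q.isProbabilityMeasure_law (P := P) hξ_meas
  have hq : ∀ k i, 0 ≤ Q.q k i := fun k i => (Q.q_pos k i).le
  have hsum : ∀ k, Summable fun i => √(p k i * Q.q k i) := fun k =>
    summable_sqrt_mul (hp_nonneg k) (hq k) (hp_sum k).summable (Q.q_sum k).summable
  have hgreatest : ∀ k, ∃ i, IsGreatest (Set.range (p k)) (p k i) := fun k =>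
    isGreatest_of_hasSum_one (hp_nonneg k) (hp_sum k)
  choose m hm using hgreatest
  have hsup : ∀ k, ⨆ i, p k i = p k (m k) := fun k => (hm k).csSup_eq
  have hp_le : ∀ k i, p k i ≤ 1 := fun k i => le_hasSum (hp_sum k) i fun j _ => hp_nonneg k j
  have hr_le : ∀ k, ∑' i, √(p k i * Q.q k i) ≤ 1 := fun k => by
    have := hasSum_le (fun i => sqrt_mul_le_half_add (hp_nonneg k i) (hq k i)) (hsum k).hasSum
      (((hp_sum k).add (Q.q_sum k)).div_const 2)
    linarith
  obtain ⟨ρ, hρ0, hρle, hρlim⟩ := exists_tendsto_prod_range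
    (fun k => tsum_nonneg fun i => Real.sqrt_nonneg (p k i * Q.q k i)) hr_le
  obtain ⟨M, hM0, hMle, hMlim⟩ := exists_tendsto_prod_range (x := fun k => ⨆ i, p k i)
    (fun k => by rw [hsup]; exact hp_nonneg k _) (fun k => by rw [hsup]; exact hp_le k _)
  have hac : 0 < ρ → IsPurelyAC (Q.law P ξ) := fun h =>
    Q.law_absolutelyContinuous hp_nonneg hp_sum hξ_meas hξ_indep hξ_law h hρle hρlim
  have hsing : ρ = 0 → Q.law P ξ ⟂ₘ volume := fun h =>
    Q.law_mutuallySingular hp_nonneg hp_sum hξ_meas hξ_indep hξ_law (h ▸ hρlim)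
  have hatoms : M = 0 → ∀ x, Q.law P ξ {x} = 0 := fun h =>
    Q.law_singleton_eq_zero hp_nonneg (fun k => ⟨_, (hm k).2⟩) hξ_meas hξ_indep hξ_law (h ▸ hMlim)
  have hpp : 0 < M → IsPurelyPoint (Q.law P ξ) := fun h => by
    refine Q.law_isPurelyPoint hξ_meas hξ_law hp_nonneg m ?_
    simp only [hsup] at hMle
    refine summable_one_sub_of_prod_ge (fun k => hp_le k _) h (fun k => ?_) hMle
    -- A zero factor at `k` would make the partial product of length `k + 1` vanish.
    refine (hp_nonneg k _).lt_of_ne fun h0 => (h.trans_le (hMle (k + 1))).ne' ?_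
    rw [Finset.prod_range_succ, ← h0, mul_zero]
  have hne : Q.law P ξ ≠ 0 := IsProbabilityMeasure.ne_zero _
  have hnot_ac_sing : IsPurelyAC (Q.law P ξ) → ¬ Q.law P ξ ⟂ₘ volume := fun h1 h2 =>
    hne (Measure.eq_zero_of_absolutelyContinuous_of_mutuallySingular h1 h2)
  have hnot_pp_atoms : IsPurelyPoint (Q.law P ξ) → ¬ ∀ x, Q.law P ξ {x} = 0 := by
    rintro ⟨S, hS, hSc⟩ h
    have h0 : Q.law P ξ S = 0 := by
      rw [← Set.biUnion_of_singleton S]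
      exact (measure_biUnion_null_iff hS).mpr fun x _ => h x
    refine hne (Measure.measure_univ_eq_zero.mp ?_)
    rw [← Set.union_compl_self S]
    exact measure_union_null h0 hSc
  have hnot_ac_pp : IsPurelyAC (Q.law P ξ) → ¬ IsPurelyPoint (Q.law P ξ) := fun h1 h2 =>
    hnot_pp_atoms h2 fun x => h1 Real.volume_singleton
  refine ⟨?_, fun h => hnot_ac_pp h.1 h.2, fun h => hnot_ac_sing h.1 h.2.2,
    fun h => hnot_pp_atoms h.1 h.2.1, hsum, fun k => ⟨m k, hm k⟩, ρ, M, hρlim, hMlim,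
    ⟨fun h => ?_, hac⟩, ⟨fun h => ?_, hpp⟩, ⟨fun h => ⟨?_, ?_⟩, fun h => ⟨hatoms h.2, hsing h.1⟩⟩⟩
  · rcases hρ0.eq_or_lt' with h | h
    · rcases hM0.eq_or_lt' with h' | h'
      · exact Or.inr (Or.inr ⟨hatoms h', hsing h⟩)
      · exact Or.inr (Or.inl (hpp h'))
    · exact Or.inl (hac h)
  · exact hρ0.lt_of_ne' fun h0 => hnot_ac_sing h (hsing h0)
  · exact hM0.lt_of_ne' fun h0 => hnot_pp_atoms h (hatoms h0)
  · by_contra h0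
    exact hnot_ac_sing (hac (hρ0.lt_of_ne' h0)) h.2
  · by_contra h0
    exact hnot_pp_atoms (hpp (hM0.lt_of_ne' h0)) h.1
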